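/- **Proposition 1.1.** Let $(M,g)$ be a smooth connected (Hausdorff, finite-dimensional, boundaryless) Riemannian manifold with Levi-Civita connection $\nabla$, and let $S$ be a smooth field of endomorphisms of $TM$ that is symmetric, i.e. $g(SX,Y)=g(X,SY)$ for all $x\in M$ and $X,Y\in T_xM$. Write $\nabla S(X,Y)=(\nabla_X S)Y$ and $\Phi(X,Y)=g(SX,Y)$. A smooth endomorphism field $S$ is called a *Killing tensor* if it is symmetric and $g(\nabla S(X,X),X)=0$ for all $X\in TM$. Then the following conditions are equivalent: (a) $S$ is a Killing tensor on $(M,g)$; (b) for every geodesic $\gamma:J\to M$, where $J\subseteq\mathbb R$ is an open interval, the function $t\mapsto\Phi(\gamma'(t),\gamma'(t))$ is constant on $J$; (c) for all smooth vector fields $X,Y,Z$ on $M$, $$(\nabla_X\Phi)(Y,Z)+(\nabla_Z\Phi)(X,Y)+(\nabla_Y\Phi)(Z,X)=0 .$$ -/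

import Mathlib

set_option linter.unusedSectionVars false

open Bundle Manifold
open scoped ContDiff Topology

noncomputable section

namespace RiemannianGeometry

section Connection

section Trilinear

variable {V W : Type*} [AddCommGroup V] [Module ℝ V] [TopologicalSpace V]
  [AddCommGroup W] [Module ℝ W] [TopologicalSpace W]

lemma trilinear_add (A : V →L[ℝ] V →L[ℝ] W →L[ℝ] ℝ) (a a' b : V) (c : W) :
    A (a + a') b c = A a b c + A a' b c := by
  rw [ContinuousLinearMap.map_add A a a']
  rfl

lemma trilinear_smul (A : V →L[ℝ] V →L[ℝ] W →L[ℝ] ℝ) (r : ℝ) (a b : V) (c : W) :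
    A (r • a) b c = r * A a b c := by
  rw [ContinuousLinearMap.map_smul A r a]
  rfl

end Trilinear

variable {E : Type*} [NormedAddCommGroup E] [NormedSpace ℝ E]
  {M : Type*} [TopologicalSpace M] [ChartedSpace E M] [IsManifold 𝓘(ℝ, E) ∞ M]

/-- The coordinate expression of a vector field `Y` in the trivialization of `TM` induced by the
preferred chart at `x`: near `x` it sends `y` to the components of `Y y` in that chart. -/
def coordField (x : M) (Y : Π y : M, TangentSpace 𝓘(ℝ, E) y) (y : M) : E :=
  (trivializationAt E (TangentSpace 𝓘(ℝ, E) : M → Type _) x ⟨y, Y y⟩).2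

/-- Componentwise derivative at `x` of a vector field in the preferred chart at `x`. -/
def flatDeriv (Y : Π y : M, TangentSpace 𝓘(ℝ, E) y) (x : M) :
    TangentSpace 𝓘(ℝ, E) x →L[ℝ] TangentSpace 𝓘(ℝ, E) x :=
  ((trivializationAt E (TangentSpace 𝓘(ℝ, E) : M → Type _) x).symmL ℝ x).comp
    (mvfderiv 𝓘(ℝ, E) (coordField x Y) x)

lemma mdifferentiableAt_coordField {x : M} {Y : Π y : M, TangentSpace 𝓘(ℝ, E) y}
    (hY : MDiffAt (T% Y) x) : MDiffAt (coordField x Y) x :=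
  (mdifferentiableAt_section (F := E) (IB := 𝓘(ℝ, E)) Y (b₀ := x)).1 hY

lemma eventually_mem_baseSet (x : M) : ∀ᶠ y in 𝓝 x,
    y ∈ (trivializationAt E (TangentSpace 𝓘(ℝ, E) : M → Type _) x).baseSet :=
  (trivializationAt E (TangentSpace 𝓘(ℝ, E) : M → Type _) x).open_baseSet.mem_nhds
    (FiberBundle.mem_baseSet_trivializationAt' x)

lemma mvfderiv_congr_of_eventuallyEq {F : Type*} [NormedAddCommGroup F] [NormedSpace ℝ F]
    {f g : M → F} {x : M} (h : f =ᶠ[𝓝 x] g) :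
    mvfderiv 𝓘(ℝ, E) f x = mvfderiv 𝓘(ℝ, E) g x := by
  have := Filter.EventuallyEq.mfderiv_eq (I := 𝓘(ℝ, E)) (I' := 𝓘(ℝ, F)) h
  exact this

lemma flatDeriv_isCovariantDerivativeOn :
    IsCovariantDerivativeOn (I := 𝓘(ℝ, E)) (M := M) E flatDeriv Set.univ where
  add {Y Z x} hY hZ _ := by
    have h : coordField x (Y + Z) =ᶠ[𝓝 x] coordField x Y + coordField x Z := by
      filter_upwards [eventually_mem_baseSet (E := E) x] with y hy
      exact ((trivializationAt E (TangentSpace 𝓘(ℝ, E) : M → Type _) x).linear ℝ hy).1 _ _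
    have h2 : mvfderiv 𝓘(ℝ, E) (coordField x (Y + Z)) x
        = mvfderiv 𝓘(ℝ, E) (coordField x Y) x + mvfderiv 𝓘(ℝ, E) (coordField x Z) x := by
      rw [← mvfderiv_add (mdifferentiableAt_coordField hY) (mdifferentiableAt_coordField hZ)]
      exact mvfderiv_congr_of_eventuallyEq h
    simp only [flatDeriv, h2, ContinuousLinearMap.comp_add]
  leibniz {Y f x} hY hf _ := by
    have h : coordField x (f • Y) =ᶠ[𝓝 x] f • coordField x Y := by
      filter_upwards [eventually_mem_baseSet (E := E) x] with y hy
      exact ((trivializationAt E (TangentSpace 𝓘(ℝ, E) : M → Type _) x).linear ℝ hy).2 _ _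
    have h2 := mvfderiv_congr_of_eventuallyEq (E := E) h
    rw [mvfderiv_smul hf (mdifferentiableAt_coordField hY)] at h2
    ext v
    have h3 : (trivializationAt E (TangentSpace 𝓘(ℝ, E) : M → Type _) x).symmL ℝ x
        (coordField x Y x) = Y x := by
      rw [Trivialization.symmL_apply _ (FiberBundle.mem_baseSet_trivializationAt' x)]
      exact (trivializationAt E (TangentSpace 𝓘(ℝ, E) : M → Type _) x).symm_apply_apply_mk
        (FiberBundle.mem_baseSet_trivializationAt' x) (Y x)
    simp [flatDeriv, h2, h3]

/-- The covariant derivative which at each point `x` differentiates components in the preferred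
chart at `x`. It serves as a reference to write down the Levi-Civita connection. -/
def flatConnection : CovariantDerivative 𝓘(ℝ, E) E (TangentSpace 𝓘(ℝ, E) : M → Type _) where
  toFun := flatDeriv
  isCovariantDerivativeOnUniv := flatDeriv_isCovariantDerivativeOn

lemma flatConnection_extend {x : M} (v : TangentSpace 𝓘(ℝ, E) x) :
    flatConnection (FiberBundle.extend E v) x = 0 := by
  have h : coordField x (FiberBundle.extend E v) =ᶠ[𝓝 x]
      fun _ ↦ (trivializationAt E (TangentSpace 𝓘(ℝ, E) : M → Type _) x ⟨x, v⟩).2 := by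
    filter_upwards [eventually_mem_baseSet (E := E) x] with y hy
    simp only [coordField, FiberBundle.extend]
    rw [(trivializationAt E (TangentSpace 𝓘(ℝ, E) : M → Type _) x).apply_mk_symm hy]
  change flatDeriv _ x = 0
  rw [flatDeriv, mvfderiv_congr_of_eventuallyEq h, mvfderiv_const]
  exact ContinuousLinearMap.comp_zero _

lemma mpullbackWithin_extend {x : M} (v : TangentSpace 𝓘(ℝ, E) x) :
    VectorField.mpullbackWithin 𝓘(ℝ, E) 𝓘(ℝ, E) (extChartAt 𝓘(ℝ, E) x).symm
      (FiberBundle.extend E v) (Set.range 𝓘(ℝ, E)) =ᶠ[𝓝 (extChartAt 𝓘(ℝ, E) x x)]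
      fun _ ↦ (trivializationAt E (TangentSpace 𝓘(ℝ, E) : M → Type _) x ⟨x, v⟩).2 := by
  filter_upwards [extChartAt_target_mem_nhds (I := 𝓘(ℝ, E)) x] with y hy
  have hy' : (extChartAt 𝓘(ℝ, E) x).symm y ∈ (chartAt E x).source := by
    simpa using (extChartAt 𝓘(ℝ, E) x).map_target hy
  refine (isInvertible_mfderivWithin_extChartAt_symm hy).inverse_apply_eq.2 ?_
  have h := TangentBundle.symmL_trivializationAt (I := 𝓘(ℝ, E)) hy'
  rw [(extChartAt 𝓘(ℝ, E) x).right_inv hy] at h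
  exact (Trivialization.symmL_apply (R := ℝ)
    (trivializationAt E (TangentSpace 𝓘(ℝ, E) : M → Type _) x) (by simpa using hy') _).symm.trans
    (congrArg (fun L : E →L[ℝ] E ↦
      L (trivializationAt E (TangentSpace 𝓘(ℝ, E) : M → Type _) x ⟨x, v⟩).2) h)

/-- Coordinate vector fields commute. -/
lemma mlieBracket_extend {x : M} (v w : TangentSpace 𝓘(ℝ, E) x) :
    VectorField.mlieBracket 𝓘(ℝ, E) (FiberBundle.extend E v) (FiberBundle.extend E w) x = 0 := by
  rw [VectorField.mlieBracket, VectorField.mlieBracketWithin_apply,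
    (mpullbackWithin_extend v).lieBracketWithin_vectorField_eq_nhds (mpullbackWithin_extend w)]
  simp only [VectorField.lieBracketWithin, fderivWithin_fun_const, Pi.zero_apply, zero_apply,
    sub_zero]
  exact map_zero (ContinuousLinearMap.inverse _)

variable [FiniteDimensional ℝ E]

lemma finiteDimensional_tangentSpace (x : M) : FiniteDimensional ℝ (TangentSpace 𝓘(ℝ, E) x) :=
  inferInstanceAs (FiniteDimensional ℝ E)

variable [RiemannianBundle (TangentSpace 𝓘(ℝ, E) : M → Type _)]
  [IsContMDiffRiemannianBundle 𝓘(ℝ, E) ∞ E (TangentSpace 𝓘(ℝ, E) : M → Type _)]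

/-- The first derivatives of the metric at `x`: `metricDeriv x a b c = ∂_c g(a, b)`, where `a`, `b`
are extended near `x` with constant components in the preferred chart at `x`. -/
def metricDeriv (x : M) (a b c : TangentSpace 𝓘(ℝ, E) x) : ℝ :=
  mvfderiv 𝓘(ℝ, E)
    (fun y ↦ inner ℝ (FiberBundle.extend E a y) (FiberBundle.extend E b y)) x c

lemma metricDeriv_symm (x : M) (a b c : TangentSpace 𝓘(ℝ, E) x) :
    metricDeriv x a b c = metricDeriv x b a c := by
  simp only [metricDeriv, real_inner_comm]

lemma metricDeriv_eq (x : M) (a b c : TangentSpace 𝓘(ℝ, E) x) :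
    CovariantDerivative.derivMetricTensor (V := (TangentSpace 𝓘(ℝ, E) : M → Type _))
      flatConnection x a b c = metricDeriv x a b c := by
  rw [CovariantDerivative.derivMetricTensor_apply_eq_extend]
  simp [flatConnection_extend, metricDeriv]

lemma metricDeriv_add_left (x : M) (a a' b c : TangentSpace 𝓘(ℝ, E) x) :
    metricDeriv x (a + a') b c = metricDeriv x a b c + metricDeriv x a' b c := by
  simp only [← metricDeriv_eq]
  exact trilinear_add _ a a' b c

lemma metricDeriv_smul_left (x : M) (r : ℝ) (a b c : TangentSpace 𝓘(ℝ, E) x) :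
    metricDeriv x (r • a) b c = r * metricDeriv x a b c := by
  simp only [← metricDeriv_eq]
  exact trilinear_smul _ r a b c

lemma metricDeriv_add_middle (x : M) (a b b' c : TangentSpace 𝓘(ℝ, E) x) :
    metricDeriv x a (b + b') c = metricDeriv x a b c + metricDeriv x a b' c := by
  rw [metricDeriv_symm, metricDeriv_add_left, metricDeriv_symm x b, metricDeriv_symm x b']

lemma metricDeriv_smul_middle (x : M) (r : ℝ) (a b c : TangentSpace 𝓘(ℝ, E) x) :
    metricDeriv x a (r • b) c = r * metricDeriv x a b c := by
  rw [metricDeriv_symm, metricDeriv_smul_left, metricDeriv_symm x b]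

lemma metricDeriv_add_right (x : M) (a b c c' : TangentSpace 𝓘(ℝ, E) x) :
    metricDeriv x a b (c + c') = metricDeriv x a b c + metricDeriv x a b c' :=
  map_add _ _ _

lemma metricDeriv_smul_right (x : M) (r : ℝ) (a b c : TangentSpace 𝓘(ℝ, E) x) :
    metricDeriv x a b (r • c) = r * metricDeriv x a b c :=
  map_smul _ _ _

/-- Christoffel symbols of the first kind:
`Γ(w, v; z) = (∂_v g(w, z) + ∂_w g(v, z) - ∂_z g(v, w)) / 2`, as a linear form in `z`. -/
def christoffelFirst (x : M) (w v : TangentSpace 𝓘(ℝ, E) x) : TangentSpace 𝓘(ℝ, E) x →L[ℝ] ℝ :=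
  haveI := finiteDimensional_tangentSpace (E := E) x
  LinearMap.toContinuousLinearMap
    { toFun := fun z ↦ (metricDeriv x w z v + metricDeriv x v z w - metricDeriv x v w z) / 2
      map_add' := fun z z' ↦ by
        rw [metricDeriv_add_middle, metricDeriv_add_middle, metricDeriv_add_right]
        ring
      map_smul' := fun c z ↦ by
        rw [metricDeriv_smul_middle, metricDeriv_smul_middle, metricDeriv_smul_right]
        simp only [smul_eq_mul, RingHom.id_apply]
        ring }

lemma christoffelFirst_apply (x : M) (w v z : TangentSpace 𝓘(ℝ, E) x) :
    christoffelFirst x w v z =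
      (metricDeriv x w z v + metricDeriv x v z w - metricDeriv x v w z) / 2 := rfl

lemma christoffelFirst_symm (x : M) (w v : TangentSpace 𝓘(ℝ, E) x) :
    christoffelFirst x w v = christoffelFirst x v w := by
  ext z
  rw [christoffelFirst_apply, christoffelFirst_apply, metricDeriv_symm x v w]
  ring

lemma christoffelFirst_add (x : M) (w w' v : TangentSpace 𝓘(ℝ, E) x) :
    christoffelFirst x (w + w') v = christoffelFirst x w v + christoffelFirst x w' v := by
  ext z
  rw [add_apply, christoffelFirst_apply, christoffelFirst_apply,
    christoffelFirst_apply, metricDeriv_add_left, metricDeriv_add_middle, metricDeriv_add_right]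
  ring

lemma christoffelFirst_smul (x : M) (c : ℝ) (w v : TangentSpace 𝓘(ℝ, E) x) :
    christoffelFirst x (c • w) v = c • christoffelFirst x w v := by
  ext z
  rw [smul_apply, christoffelFirst_apply, christoffelFirst_apply,
    metricDeriv_smul_left, metricDeriv_smul_middle, metricDeriv_smul_right, smul_eq_mul]
  ring

/-- Christoffel symbols of the second kind: `⟪Γ(w, v), z⟫ = Γ(w, v; z)`. -/
def christoffel (x : M) : TangentSpace 𝓘(ℝ, E) x →L[ℝ] TangentSpace 𝓘(ℝ, E) x →L[ℝ]
    TangentSpace 𝓘(ℝ, E) x :=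
  haveI := finiteDimensional_tangentSpace (E := E) x
  haveI : CompleteSpace (TangentSpace 𝓘(ℝ, E) x) := FiniteDimensional.complete ℝ _
  (LinearMap.mk₂ ℝ
    (fun w v ↦ (InnerProductSpace.toDual ℝ (TangentSpace 𝓘(ℝ, E) x)).symm (christoffelFirst x w v))
    (fun w w' v ↦ by rw [christoffelFirst_add, map_add])
    (fun c w v ↦ by rw [christoffelFirst_smul]; simp)
    (fun w v v' ↦ by simp only [christoffelFirst_symm x w, christoffelFirst_add, map_add])
    (fun c w v ↦ by simp only [christoffelFirst_symm x w, christoffelFirst_smul]; simp)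
    ).toContinuousBilinearMap

lemma inner_christoffel (x : M) (w v z : TangentSpace 𝓘(ℝ, E) x) :
    inner ℝ (christoffel x w v) z = christoffelFirst x w v z := by
  have := finiteDimensional_tangentSpace (E := E) x
  have : CompleteSpace (TangentSpace 𝓘(ℝ, E) x) := FiniteDimensional.complete ℝ _
  simp [christoffel]

variable (E M) in
/-- The Levi-Civita connection, `∇_v Y = ∂_v Y + Γ(Y, v)` in the preferred chart at each point. -/
def leviCivita : CovariantDerivative 𝓘(ℝ, E) E (TangentSpace 𝓘(ℝ, E) : M → Type _) :=
  flatConnection.addOneForm christoffel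

lemma leviCivita_extend {x : M} (w v : TangentSpace 𝓘(ℝ, E) x) :
    leviCivita E M (FiberBundle.extend E w) x v = christoffel x w v := by
  change (flatConnection (FiberBundle.extend E w) x + christoffel x (FiberBundle.extend E w x)) v
    = _
  simp [flatConnection_extend]

lemma christoffel_symm (x : M) (w v : TangentSpace 𝓘(ℝ, E) x) :
    christoffel x w v = christoffel x v w := by
  refine ext_inner_right ℝ fun z ↦ ?_
  rw [inner_christoffel, inner_christoffel, christoffelFirst_symm]

theorem leviCivita_isMetricCompatible :
    CovariantDerivative.IsMetricCompatible (V := (TangentSpace 𝓘(ℝ, E) : M → Type _))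
      (leviCivita E M) := by
  rw [CovariantDerivative.IsMetricCompatible]
  ext x a b c
  rw [CovariantDerivative.derivMetricTensor_apply_eq_extend, leviCivita_extend, leviCivita_extend,
    ← metricDeriv, real_inner_comm (christoffel x b c), inner_christoffel, inner_christoffel]
  simp [christoffelFirst_apply, metricDeriv_symm x b a, metricDeriv_symm x c]
  ring

theorem leviCivita_torsion : (leviCivita E M).torsion = 0 := by
  ext x v w
  rw [CovariantDerivative.torsion_apply_eq_extend, mlieBracket_extend]
  simp [leviCivita_extend, christoffel_symm x v w]

end Connection

section Killing

variable {E : Type*} [NormedAddCommGroup E] [NormedSpace ℝ E] [FiniteDimensional ℝ E]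
  {M : Type*} [TopologicalSpace M] [ChartedSpace E M] [IsManifold 𝓘(ℝ, E) ∞ M]
  [RiemannianBundle (TangentSpace 𝓘(ℝ, E) : M → Type _)]
  [IsContMDiffRiemannianBundle 𝓘(ℝ, E) ∞ E (TangentSpace 𝓘(ℝ, E) : M → Type _)]

/-- The field of endomorphisms `S` is a smooth section of `End(TM)`. -/
def IsSmoothEndomorphism
    (S : Π x : M, TangentSpace 𝓘(ℝ, E) x →L[ℝ] TangentSpace 𝓘(ℝ, E) x) : Prop :=
  ContMDiff 𝓘(ℝ, E) (𝓘(ℝ, E).prod 𝓘(ℝ, E →L[ℝ] E)) ∞ (fun x ↦ TotalSpace.mk' (E →L[ℝ] E)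
    (E := fun y : M ↦ TangentSpace 𝓘(ℝ, E) y →L[ℝ] TangentSpace 𝓘(ℝ, E) y) x (S x))

/-- `X` is a smooth vector field on `M`. -/
def IsSmoothVectorField (X : Π x : M, TangentSpace 𝓘(ℝ, E) x) : Prop :=
  ContMDiff 𝓘(ℝ, E) 𝓘(ℝ, E).tangent ∞ (T% X)

/-- The endomorphism field `S` is symmetric with respect to the metric. -/
def IsSymmetricEndomorphism
    (S : Π x : M, TangentSpace 𝓘(ℝ, E) x →L[ℝ] TangentSpace 𝓘(ℝ, E) x) : Prop :=
  ∀ (x : M) (v w : TangentSpace 𝓘(ℝ, E) x), inner ℝ (S x v) w = inner ℝ v (S x w)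

/-- The covariant derivative `∇S(v, w) = (∇_v S) w = ∇_v (S W) - S (∇_v W)` at `x`, where `W` is
any differentiable vector field with `W x = w`; see `covDerivEnd_eq` for the independence of the
choice of `W`. -/
def covDerivEnd (S : Π x : M, TangentSpace 𝓘(ℝ, E) x →L[ℝ] TangentSpace 𝓘(ℝ, E) x)
    (x : M) (v w : TangentSpace 𝓘(ℝ, E) x) : TangentSpace 𝓘(ℝ, E) x :=
  leviCivita E M (fun y ↦ S y (FiberBundle.extend E w y)) x v
    - S x (leviCivita E M (FiberBundle.extend E w) x v)

lemma covDerivEnd_eq {S : Π x : M, TangentSpace 𝓘(ℝ, E) x →L[ℝ] TangentSpace 𝓘(ℝ, E) x}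
    (hS : IsSmoothEndomorphism S) {x : M} {W : Π y : M, TangentSpace 𝓘(ℝ, E) y}
    (hW : MDiffAt (T% W) x) (v : TangentSpace 𝓘(ℝ, E) x) :
    covDerivEnd S x v (W x) =
      leviCivita E M (fun y ↦ S y (W y)) x v - S x (leviCivita E M W x v) := by
  have hSx {Z : Π y : M, TangentSpace 𝓘(ℝ, E) y} (hZ : MDiffAt (T% Z) x) :
      MDiffAt (T% (fun y ↦ S y (Z y))) x :=
    MDifferentiableAt.clm_bundle_apply (hS.mdifferentiableAt (by simp)) hZ
  have hT : TensorialAt 𝓘(ℝ, E) E (fun Z : Π y : M, TangentSpace 𝓘(ℝ, E) y ↦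
      leviCivita E M (fun y ↦ S y (Z y)) x v - S x (leviCivita E M Z x v)) x := by
    refine ⟨fun {f Z} hf hZ ↦ ?_, fun {Z Z'} hZ hZ' ↦ ?_⟩
    · have h : (fun y ↦ S y ((f • Z) y)) = f • (fun y ↦ S y (Z y)) := by ext; simp
      rw [h, (leviCivita E M).isCovariantDerivativeOn.leibniz (hSx hZ) hf (Set.mem_univ x),
        (leviCivita E M).isCovariantDerivativeOn.leibniz hZ hf (Set.mem_univ x)]
      simp
      module
    · have h : (fun y ↦ S y ((Z + Z') y)) = (fun y ↦ S y (Z y)) + (fun y ↦ S y (Z' y)) := by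
        ext; simp
      rw [h, (leviCivita E M).isCovariantDerivativeOn.add (hSx hZ) (hSx hZ') (Set.mem_univ x),
        (leviCivita E M).isCovariantDerivativeOn.add hZ hZ' (Set.mem_univ x)]
      simp
      module
  exact hT.pointwise (FiberBundle.mdifferentiableAt_extend ..) hW (by simp)

/-- A Killing tensor: a smooth endomorphism field `S` of `TM` which is symmetric and satisfies
`g(∇S(v, v), v) = 0` for every tangent vector `v`. -/
structure IsKillingTensor
    (S : Π x : M, TangentSpace 𝓘(ℝ, E) x →L[ℝ] TangentSpace 𝓘(ℝ, E) x) : Prop where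
  smooth : IsSmoothEndomorphism S
  symm : IsSymmetricEndomorphism S
  killing : ∀ (x : M) (v : TangentSpace 𝓘(ℝ, E) x), inner ℝ (covDerivEnd S x v v) v = 0

/-- The bilinear form `Φ(v, w) = g(S v, w)`. -/
def assocForm (S : Π x : M, TangentSpace 𝓘(ℝ, E) x →L[ℝ] TangentSpace 𝓘(ℝ, E) x)
    (x : M) (v w : TangentSpace 𝓘(ℝ, E) x) : ℝ :=
  inner ℝ (S x v) w

/-- The covariant derivative of a field of bilinear forms,
`(∇_X Φ)(Y, Z) = X(Φ(Y, Z)) - Φ(∇_X Y, Z) - Φ(Y, ∇_X Z)`. -/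
def covDerivForm (Φ : Π x : M, TangentSpace 𝓘(ℝ, E) x → TangentSpace 𝓘(ℝ, E) x → ℝ)
    (X Y Z : Π x : M, TangentSpace 𝓘(ℝ, E) x) (x : M) : ℝ :=
  mvfderiv 𝓘(ℝ, E) (fun y ↦ Φ y (Y y) (Z y)) x (X x)
    - Φ x (leviCivita E M Y x (X x)) (Z x) - Φ x (Y x) (leviCivita E M Z x (X x))

/-- The velocity vector `γ'(t)`. -/
def velocity (γ : ℝ → M) (t : ℝ) : TangentSpace 𝓘(ℝ, E) (γ t) :=
  mfderiv 𝓘(ℝ, ℝ) 𝓘(ℝ, E) γ t (1 : ℝ)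

/-- The covariant derivative along the curve `γ`, at time `t`, of a vector field `V` along `γ`:
if `V = ∑ Vⁱ ∂ᵢ` in the preferred chart at `γ t`, it is `∑ (dVⁱ/dt) ∂ᵢ + ∑ Vⁱ ∇_{γ'} ∂ᵢ`. -/
def covDerivAlong (γ : ℝ → M) (V : Π t : ℝ, TangentSpace 𝓘(ℝ, E) (γ t)) (t : ℝ) :
    TangentSpace 𝓘(ℝ, E) (γ t) :=
  (trivializationAt E (TangentSpace 𝓘(ℝ, E) : M → Type _) (γ t)).symmL ℝ (γ t)
      (deriv (fun s ↦
        (trivializationAt E (TangentSpace 𝓘(ℝ, E) : M → Type _) (γ t) ⟨γ s, V s⟩).2) t)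
    + leviCivita E M (FiberBundle.extend E (V t)) (γ t) (velocity γ t)

/-- For the restriction to `γ` of a vector field `Y` on `M`, `covDerivAlong` is `∇_{γ'} Y`. -/
lemma covDerivAlong_comp {γ : ℝ → M} {Y : Π y : M, TangentSpace 𝓘(ℝ, E) y} {t : ℝ}
    (hγ : MDifferentiableAt 𝓘(ℝ, ℝ) 𝓘(ℝ, E) γ t) (hY : MDiffAt (T% Y) (γ t)) :
    covDerivAlong γ (fun s ↦ Y (γ s)) t = leviCivita E M Y (γ t) (velocity γ t) := by
  have h1 : deriv (fun s ↦ coordField (γ t) Y (γ s)) t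
      = mvfderiv 𝓘(ℝ, E) (coordField (γ t) Y) (γ t) (velocity γ t) := by
    have h2 := mfderiv_comp t (mdifferentiableAt_coordField hY) hγ
    have h3 := congrArg (fun L : ℝ →L[ℝ] E ↦ L 1) h2
    rw [← fderiv_apply_one_eq_deriv, ← mfderiv_eq_fderiv]
    exact h3
  have h4 : leviCivita E M Y (γ t) (velocity γ t)
      = flatDeriv Y (γ t) (velocity γ t) + christoffel (γ t) (Y (γ t)) (velocity γ t) := rfl
  rw [h4, covDerivAlong, leviCivita_extend]
  congr 1
  exact congrArg _ h1

variable (E) in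
/-- `γ` restricted to the open interval `J` is a geodesic: a `C²` curve whose velocity field is
parallel along it. (Such curves are automatically smooth.) -/
structure IsGeodesicOn (γ : ℝ → M) (J : Set ℝ) : Prop where
  isOpen : IsOpen J
  isPreconnected : IsPreconnected J
  contMDiffOn : ContMDiffOn 𝓘(ℝ, ℝ) 𝓘(ℝ, E) 2 γ J
  covDerivAlong_velocity : ∀ t ∈ J, covDerivAlong γ (velocity (E := E) γ) t = 0

end Killing

end RiemannianGeometry

end

noncomputable section

namespace RiemannianGeometry

/-! ### The tensor ∇S, polarization, and the cyclic identity. -/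

section TensorAlgebra

variable {E : Type*} [NormedAddCommGroup E] [NormedSpace ℝ E] [FiniteDimensional ℝ E]
  {M : Type*} [TopologicalSpace M] [ChartedSpace E M] [IsManifold 𝓘(ℝ, E) ∞ M]
  [RiemannianBundle (TangentSpace 𝓘(ℝ, E) : M → Type _)]
  [IsContMDiffRiemannianBundle 𝓘(ℝ, E) ∞ E (TangentSpace 𝓘(ℝ, E) : M → Type _)]
  {S : Π x : M, TangentSpace 𝓘(ℝ, E) x →L[ℝ] TangentSpace 𝓘(ℝ, E) x}

/-! Everything is governed by the cubic form v ↦ g(∇S(v, v), v). Since ∇g = 0,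
`covDerivForm_assocForm` identifies (∇_X Φ)(Y, Z) with g(∇S(X, Y), Z), which is symmetric in Y and Z
because S is symmetric. The cyclic sum is therefore, up to a factor, the polarization of the cubic
form: it vanishes with that form (`IsKillingTensor.cyclic_sum_eq_zero`), and taking X = Y = Z
recovers the form, every tangent vector being the value of a global smooth field.

Along a curve, `hasDerivAt_assocForm_sum_smul` gives d/dt Φ(V, V) = g(∇S(γ', V), V) + Φ(DV, V) +
Φ(V, DV). For V = γ' on a geodesic the last two terms vanish, so the derivative of Φ(γ', γ') is the
cubic form at γ'. The Killing condition thus makes Φ(γ', γ') constant on the interval. Conversely,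
constancy kills the cubic form at every initial velocity, and by `exists_isGeodesicOn` every tangent
vector is one.

Existence of geodesics is the laborious part. Picard–Lindelöf needs C¹ Christoffel symbols, whereas
`leviCivita` is defined at each point in a chart depending on that point, so its regularity is not
visible. The Koszul formula, a consequence of metric compatibility and zero torsion, expresses g(∇_a
∂_b, ∂_c) in one fixed chart through C¹ functions; inverting the Gram matrix then gives the symbols
themselves. -/

lemma IsSmoothEndomorphism.mdifferentiableAt_apply (hS : IsSmoothEndomorphism S) {x : M}
    {Z : Π y : M, TangentSpace 𝓘(ℝ, E) y} (hZ : MDiffAt (T% Z) x) :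
    MDiffAt (T% (fun y ↦ S y (Z y))) x :=
  MDifferentiableAt.clm_bundle_apply (hS.mdifferentiableAt (by simp)) hZ

/-- Metric compatibility of the Levi-Civita connection, at a tangent vector. -/
lemma mvfderiv_inner_leviCivita {x : M} {Y Z : Π y : M, TangentSpace 𝓘(ℝ, E) y}
    (hY : MDiffAt (T% Y) x) (hZ : MDiffAt (T% Z) x) (v : TangentSpace 𝓘(ℝ, E) x) :
    mvfderiv 𝓘(ℝ, E) (fun y ↦ inner ℝ (Y y) (Z y)) x v =
      inner ℝ (leviCivita E M Y x v) (Z x) + inner ℝ (Y x) (leviCivita E M Z x v) := by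
  have h := (leviCivita_isMetricCompatible (E := E) (M := M)).mvfderiv_inner_eq
    (FiberBundle.extend E v) hY hZ
  simpa using h

lemma mdifferentiableAt_inner {x : M} {Y Z : Π y : M, TangentSpace 𝓘(ℝ, E) y}
    (hY : MDiffAt (T% Y) x) (hZ : MDiffAt (T% Z) x) :
    MDiffAt (fun y ↦ (inner ℝ (Y y) (Z y) : ℝ)) x :=
  MDifferentiableAt.inner_bundle (F := E) (IB := 𝓘(ℝ, E))
    (E := (TangentSpace 𝓘(ℝ, E) : M → Type _)) (b := fun y ↦ y) hY hZ

/-- Derivative of `Φ(Y, Z)` at a tangent vector. -/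
lemma mvfderiv_assocForm (hS : IsSmoothEndomorphism S) {x : M}
    {Y Z : Π y : M, TangentSpace 𝓘(ℝ, E) y}
    (hY : MDiffAt (T% Y) x) (hZ : MDiffAt (T% Z) x) (v : TangentSpace 𝓘(ℝ, E) x) :
    mvfderiv 𝓘(ℝ, E) (fun y ↦ assocForm S y (Y y) (Z y)) x v =
      inner ℝ (covDerivEnd S x v (Y x)) (Z x) + assocForm S x (leviCivita E M Y x v) (Z x)
        + assocForm S x (Y x) (leviCivita E M Z x v) := by
  simp only [assocForm]
  rw [mvfderiv_inner_leviCivita (hS.mdifferentiableAt_apply hY) hZ, covDerivEnd_eq hS hY,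
    inner_sub_left]
  ring

/-- The metric is parallel, so differentiating Φ = g(S·, ·) only hits S. This turns statements about
Φ into statements about ∇S. -/
lemma covDerivForm_assocForm (hS : IsSmoothEndomorphism S) {x : M}
    {X Y Z : Π y : M, TangentSpace 𝓘(ℝ, E) y}
    (hY : MDiffAt (T% Y) x) (hZ : MDiffAt (T% Z) x) :
    covDerivForm (assocForm S) X Y Z x = inner ℝ (covDerivEnd S x (X x) (Y x)) (Z x) := by
  rw [covDerivForm, mvfderiv_assocForm hS hY hZ]
  ring

lemma covDerivEnd_add_left (x : M) (v v' w : TangentSpace 𝓘(ℝ, E) x) :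
    covDerivEnd S x (v + v') w = covDerivEnd S x v w + covDerivEnd S x v' w := by
  simp only [covDerivEnd, map_add]
  abel

/-- Not immediate from the definition, which fixes one extension of each vector: independence of the
extension allows w + w' to be extended by the sum of the two extensions. -/
lemma covDerivEnd_add_right (hS : IsSmoothEndomorphism S) (x : M)
    (v w w' : TangentSpace 𝓘(ℝ, E) x) :
    covDerivEnd S x v (w + w') = covDerivEnd S x v w + covDerivEnd S x v w' := by
  have hw := FiberBundle.mdifferentiableAt_extend 𝓘(ℝ, E) E w
  have hw' := FiberBundle.mdifferentiableAt_extend 𝓘(ℝ, E) E w'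
  have h := covDerivEnd_eq hS (mdifferentiableAt_add_section hw hw') v
  have e : (fun y ↦ S y ((FiberBundle.extend E w + FiberBundle.extend E w') y)) =
      (fun y ↦ S y (FiberBundle.extend E w y)) + (fun y ↦ S y (FiberBundle.extend E w' y)) := by
    ext; simp
  rw [e, (leviCivita E M).isCovariantDerivativeOn.add (hS.mdifferentiableAt_apply hw)
      (hS.mdifferentiableAt_apply hw') (Set.mem_univ x),
    (leviCivita E M).isCovariantDerivativeOn.add hw hw' (Set.mem_univ x)] at h
  simp only [Pi.add_apply, FiberBundle.extend_apply_self, add_apply, map_add] at h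
  rw [h, covDerivEnd, covDerivEnd]
  abel

lemma covDerivEnd_smul_right (hS : IsSmoothEndomorphism S) (x : M)
    (v w : TangentSpace 𝓘(ℝ, E) x) (c : ℝ) :
    covDerivEnd S x v (c • w) = c • covDerivEnd S x v w := by
  have hw := FiberBundle.mdifferentiableAt_extend 𝓘(ℝ, E) E w
  have h := covDerivEnd_eq hS (W := c • FiberBundle.extend E w)
    (MDifferentiableAt.smul_section (f := fun _ ↦ c) mdifferentiableAt_const hw) v
  have e : (fun y ↦ S y ((c • FiberBundle.extend E w) y)) =
      c • (fun y ↦ S y (FiberBundle.extend E w y)) := by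
    ext; simp
  rw [e, (leviCivita E M).isCovariantDerivativeOn.smul_const c
      (hS.mdifferentiableAt_apply hw) (Set.mem_univ x),
    (leviCivita E M).isCovariantDerivativeOn.smul_const c hw (Set.mem_univ x)] at h
  simp only [Pi.smul_apply, FiberBundle.extend_apply_self, smul_apply, map_smul] at h
  rw [h, covDerivEnd, smul_sub]

lemma covDerivEnd_sum_smul (hS : IsSmoothEndomorphism S) (x : M) {ι : Type*} [Fintype ι]
    (v : TangentSpace 𝓘(ℝ, E) x) (c : ι → ℝ) (w : ι → TangentSpace 𝓘(ℝ, E) x) :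
    covDerivEnd S x v (∑ i, c i • w i) = ∑ i, c i • covDerivEnd S x v (w i) := by
  simp only [← covDerivEnd_smul_right hS]
  exact map_sum (AddMonoidHom.mk' (covDerivEnd S x v) (covDerivEnd_add_right hS x v))
    (fun i ↦ c i • w i) Finset.univ

/-- The covariant derivative of a symmetric endomorphism field is symmetric. -/
lemma inner_covDerivEnd_comm (hS : IsSmoothEndomorphism S) (hsymm : IsSymmetricEndomorphism S)
    (x : M) (v w z : TangentSpace 𝓘(ℝ, E) x) :
    inner ℝ (covDerivEnd S x v w) z = inner ℝ (covDerivEnd S x v z) w := by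
  have hw := FiberBundle.mdifferentiableAt_extend 𝓘(ℝ, E) E w
  have hz := FiberBundle.mdifferentiableAt_extend 𝓘(ℝ, E) E z
  -- Differentiate Φ(W, Z) = Φ(Z, W) by the product rule on each side; the terms containing ∇W and
  -- ∇Z agree by symmetry of Φ and cancel.
  have h := mvfderiv_assocForm hS hw hz v
  have h' := mvfderiv_assocForm hS hz hw v
  have hc (y : M) (a b : TangentSpace 𝓘(ℝ, E) y) : assocForm S y a b = assocForm S y b a := by
    rw [assocForm, hsymm, real_inner_comm, assocForm]
  simp only [FiberBundle.extend_apply_self] at h h'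
  rw [hc x w, hc x _ z] at h
  simp only [hc _ (FiberBundle.extend E z _)] at h'
  linarith

/-- Polarization of the Killing condition. -/
lemma IsKillingTensor.cyclic_sum_eq_zero (hS : IsKillingTensor S) (x : M)
    (u v w : TangentSpace 𝓘(ℝ, E) x) :
    inner ℝ (covDerivEnd S x u v) w + inner ℝ (covDerivEnd S x w u) v
      + inner ℝ (covDerivEnd S x v w) u = 0 := by
  have k := hS.killing x
  have c := inner_covDerivEnd_comm hS.smooth hS.symm x
  -- Inclusion–exclusion over u + v + w, the pairwise sums and the single vectors isolates the six
  -- terms in which u, v, w each occur once. Symmetry in the last two slots pairs them into twice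
  -- the cyclic sum.
  have h1 := k (u + v + w)
  have h2 := k (u + v)
  have h3 := k (u + w)
  have h4 := k (v + w)
  simp only [covDerivEnd_add_left, covDerivEnd_add_right hS.smooth, inner_add_left,
    inner_add_right] at h1 h2 h3 h4
  linarith [k u, k v, k w, c u v w, c v u w, c w u v]

/-- A tangent vector extends to a globally defined smooth vector field. -/
lemma exists_isSmoothVectorField_eq [T2Space M] (x : M) (v : TangentSpace 𝓘(ℝ, E) x) :
    ∃ X : Π y : M, TangentSpace 𝓘(ℝ, E) y, IsSmoothVectorField X ∧ X x = v := by
  obtain ⟨s, hs, hX⟩ := FiberBundle.exists_contMDiffOn_extend (k := ∞) 𝓘(ℝ, E) E v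
  -- The bump function has its support inside the open set where the local extension is smooth, so
  -- the product is smooth on all of M; it equals 1 at x.
  obtain ⟨f, -, hf⟩ := (SmoothBumpFunction.nhds_basis_tsupport (I := 𝓘(ℝ, E)) x).mem_iff.1
    (interior_mem_nhds.2 hs)
  refine ⟨(f : M → ℝ) • FiberBundle.extend E v, ?_, by simp⟩
  exact ContMDiffOn.smul_section_of_tsupport f.contMDiff.contMDiffOn isOpen_interior hf
    (hX.mono interior_subset)

theorem isKillingTensor_iff_cyclic [T2Space M] (hS : IsSmoothEndomorphism S)
    (hsymm : IsSymmetricEndomorphism S) :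
    IsKillingTensor S ↔ ∀ X Y Z : Π x : M, TangentSpace 𝓘(ℝ, E) x,
      IsSmoothVectorField X → IsSmoothVectorField Y → IsSmoothVectorField Z → ∀ x : M,
        covDerivForm (assocForm S) X Y Z x + covDerivForm (assocForm S) Z X Y x
          + covDerivForm (assocForm S) Y Z X x = 0 := by
  have hd {X : Π x : M, TangentSpace 𝓘(ℝ, E) x} (hX : IsSmoothVectorField X) (x : M) :
      MDiffAt (T% X) x := hX.mdifferentiableAt (by simp)
  refine ⟨fun h X Y Z hX hY hZ x ↦ ?_, fun h ↦ ⟨hS, hsymm, fun x v ↦ ?_⟩⟩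
  · rw [covDerivForm_assocForm hS (hd hY x) (hd hZ x), covDerivForm_assocForm hS (hd hX x) (hd hY x),
      covDerivForm_assocForm hS (hd hZ x) (hd hX x)]
    exact h.cyclic_sum_eq_zero x _ _ _
  · obtain ⟨X, hX, rfl⟩ := exists_isSmoothVectorField_eq x v
    -- On the diagonal the cyclic sum is three times the cubic form.
    have h1 := h X X X hX hX hX x
    rw [covDerivForm_assocForm hS (hd hX x) (hd hX x)] at h1
    linarith

end TensorAlgebra

/-! ### Differentiation of Φ along curves. -/

section AlongCurves

variable {E : Type*} [NormedAddCommGroup E] [NormedSpace ℝ E]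
  {M : Type*} [TopologicalSpace M] [ChartedSpace E M] [IsManifold 𝓘(ℝ, E) ∞ M]

/-- The vector field with constant components `a` in the preferred chart at `x`. -/
def coordFrame (x : M) (a : E) (y : M) : TangentSpace 𝓘(ℝ, E) y :=
  (trivializationAt E (TangentSpace 𝓘(ℝ, E) : M → Type _) x).symmL ℝ y a

lemma contMDiffAt_coordFrame {x y : M} (hy : y ∈ (chartAt E x).source) (a : E) :
    ContMDiffAt 𝓘(ℝ, E) 𝓘(ℝ, E).tangent ∞ (T% (coordFrame x a)) y := by
  set e := trivializationAt E (TangentSpace 𝓘(ℝ, E) : M → Type _) x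
  have hy' : y ∈ e.baseSet := by simpa [e] using hy
  rw [e.contMDiffAt_section_iff hy']
  refine contMDiffAt_const.congr_of_eventuallyEq (f := fun _ ↦ a) ?_
  filter_upwards [e.open_baseSet.mem_nhds hy'] with z hz
  simp only [coordFrame]
  rw [Trivialization.symmL_apply _ hz, e.apply_mk_symm hz]

lemma mdifferentiableAt_coordFrame {x y : M} (hy : y ∈ (chartAt E x).source) (a : E) :
    MDiffAt (T% (coordFrame x a)) y :=
  (contMDiffAt_coordFrame hy a).mdifferentiableAt (by simp)

/-- A tangent vector at a point of the chart at `x` is the value of a coordinate field. -/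
lemma coordFrame_trivializationAt {x y : M} (hy : y ∈ (chartAt E x).source)
    (v : TangentSpace 𝓘(ℝ, E) y) :
    coordFrame x (trivializationAt E (TangentSpace 𝓘(ℝ, E) : M → Type _) x ⟨y, v⟩).2 y = v := by
  set e := trivializationAt E (TangentSpace 𝓘(ℝ, E) : M → Type _) x
  have hy' : y ∈ e.baseSet := by simpa [e] using hy
  rw [coordFrame, Trivialization.symmL_apply _ hy', e.symm_apply_apply_mk hy']

/-- The trivialization of TM at x is the derivative of the chart at x, so this is the chain rule. -/
lemma trivializationAt_velocity {x : M} {γ : ℝ → M} {s : ℝ}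
    (hγ : MDifferentiableAt 𝓘(ℝ, ℝ) 𝓘(ℝ, E) γ s) (hx : γ s ∈ (chartAt E x).source) :
    (trivializationAt E (TangentSpace 𝓘(ℝ, E) : M → Type _) x ⟨γ s, velocity γ s⟩).2 =
      deriv (extChartAt 𝓘(ℝ, E) x ∘ γ) s := by
  set e := trivializationAt E (TangentSpace 𝓘(ℝ, E) : M → Type _) x
  have hy' : γ s ∈ e.baseSet := by simpa [e] using hx
  have h1 : e.continuousLinearMapAt ℝ (γ s) (velocity γ s) = (e ⟨γ s, velocity γ s⟩).2 := by
    rw [Trivialization.continuousLinearMapAt_apply, Trivialization.coe_linearMapAt_of_mem _ hy']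
  rw [← h1, TangentBundle.continuousLinearMapAt_trivializationAt hx,
    ← fderiv_apply_one_eq_deriv, ← mfderiv_eq_fderiv,
    mfderiv_comp s (mdifferentiableAt_extChartAt hx) hγ]
  rfl

variable [FiniteDimensional ℝ E]
  [RiemannianBundle (TangentSpace 𝓘(ℝ, E) : M → Type _)]
  [IsContMDiffRiemannianBundle 𝓘(ℝ, E) ∞ E (TangentSpace 𝓘(ℝ, E) : M → Type _)]

lemma covDerivAlong_congr {γ : ℝ → M} {V W : Π t : ℝ, TangentSpace 𝓘(ℝ, E) (γ t)} {t : ℝ}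
    (h : ∀ᶠ s in 𝓝 t, V s = W s) : covDerivAlong γ V t = covDerivAlong γ W t := by
  rw [covDerivAlong, covDerivAlong, h.self_of_nhds]
  congr 2
  apply Filter.EventuallyEq.deriv_eq
  filter_upwards [h] with s hs
  rw [hs]

/-- Leibniz rule for the covariant derivative along a curve. -/
lemma covDerivAlong_sum_smul {ι : Type*} [Fintype ι] {γ : ℝ → M} {t : ℝ}
    (hγ : MDifferentiableAt 𝓘(ℝ, ℝ) 𝓘(ℝ, E) γ t) {f : ι → ℝ → ℝ} {f' : ι → ℝ}
    (hf : ∀ i, HasDerivAt (f i) (f' i) t) {Y : ι → Π y : M, TangentSpace 𝓘(ℝ, E) y}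
    (hY : ∀ i, MDiffAt (T% (Y i)) (γ t)) :
    covDerivAlong γ (fun s ↦ ∑ i, f i s • Y i (γ s)) t =
      ∑ i, (f' i • Y i (γ t) + f i t • leviCivita E M (Y i) (γ t) (velocity γ t)) := by
  have hd (i : ι) : DifferentiableAt ℝ (fun s ↦ coordField (γ t) (Y i) (γ s)) t :=
    ((mdifferentiableAt_coordField (hY i)).comp t hγ).differentiableAt
  have h1 : (fun s ↦ (trivializationAt E (TangentSpace 𝓘(ℝ, E) : M → Type _) (γ t)
      ⟨γ s, ∑ i, f i s • Y i (γ s)⟩).2) =ᶠ[𝓝 t]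
      fun s ↦ ∑ i, f i s • coordField (γ t) (Y i) (γ s) := by
    filter_upwards [hγ.continuousAt.eventually (eventually_mem_baseSet (E := E) (γ t))] with s hs
    have h0 (w : TangentSpace 𝓘(ℝ, E) (γ s)) :
        (trivializationAt E (TangentSpace 𝓘(ℝ, E) : M → Type _) (γ t) ⟨γ s, w⟩).2 =
          (trivializationAt E (TangentSpace 𝓘(ℝ, E) : M → Type _) (γ t)).linearMapAt ℝ (γ s) w := by
      rw [Trivialization.coe_linearMapAt_of_mem _ hs]
    simp only [coordField, h0, map_sum, map_smul]
  have h2 : HasDerivAt (fun s ↦ ∑ i, f i s • coordField (γ t) (Y i) (γ s))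
      (∑ i, (f i t • deriv (fun s ↦ coordField (γ t) (Y i) (γ s)) t
        + f' i • coordField (γ t) (Y i) (γ t))) t :=
    HasDerivAt.fun_sum fun i _ ↦ (hf i).smul (hd i).hasDerivAt
  have h3 (i : ι) :
      (trivializationAt E (TangentSpace 𝓘(ℝ, E) : M → Type _) (γ t)).symmL ℝ (γ t) (coordField (γ t) (Y i) (γ t)) = Y i (γ t) :=
    coordFrame_trivializationAt (mem_chart_source E (γ t)) _
  rw [covDerivAlong, h1.deriv_eq, h2.deriv, leviCivita_extend]
  simp only [map_sum, map_add, map_smul, h3, sum_apply, smul_apply, ← covDerivAlong_comp hγ (hY _),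
    covDerivAlong, leviCivita_extend]
  rw [← Finset.sum_add_distrib]
  refine Finset.sum_congr rfl fun i _ ↦ ?_
  rw [smul_add]
  simp only [coordField]
  abel

variable {S : Π x : M, TangentSpace 𝓘(ℝ, E) x →L[ℝ] TangentSpace 𝓘(ℝ, E) x}

/-- A field along γ, such as γ', need not be the restriction of a field on M. Writing it near t as a
combination of ambient fields with time-dependent coefficients reduces the product rule to the one
on M. -/
lemma hasDerivAt_assocForm_sum_smul {ι : Type*} [Fintype ι] (hS : IsSmoothEndomorphism S)
    {γ : ℝ → M} {t : ℝ} (hγ : MDifferentiableAt 𝓘(ℝ, ℝ) 𝓘(ℝ, E) γ t)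
    {f : ι → ℝ → ℝ} {f' : ι → ℝ} (hf : ∀ i, HasDerivAt (f i) (f' i) t)
    {Y : ι → Π y : M, TangentSpace 𝓘(ℝ, E) y} (hY : ∀ i, MDiffAt (T% (Y i)) (γ t))
    {V : Π s : ℝ, TangentSpace 𝓘(ℝ, E) (γ s)} (hV : ∀ᶠ s in 𝓝 t, V s = ∑ i, f i s • Y i (γ s)) :
    HasDerivAt (fun s ↦ assocForm S (γ s) (V s) (V s))
      (inner ℝ (covDerivEnd S (γ t) (velocity γ t) (V t)) (V t)
        + assocForm S (γ t) (covDerivAlong γ V t) (V t)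
        + assocForm S (γ t) (V t) (covDerivAlong γ V t)) t := by
  have hΦ (i j : ι) : HasDerivAt (fun s ↦ assocForm S (γ s) (Y i (γ s)) (Y j (γ s)))
      (mvfderiv 𝓘(ℝ, E) (fun y ↦ assocForm S y (Y i y) (Y j y)) (γ t) (velocity γ t)) t := by
    have hd : MDiffAt (fun y ↦ assocForm S y (Y i y) (Y j y)) (γ t) :=
      mdifferentiableAt_inner (hS.mdifferentiableAt_apply (hY i)) (hY j)
    have h1 := (hd.comp t hγ).differentiableAt.hasDerivAt
    have h2 := congrArg (fun L : ℝ →L[ℝ] ℝ ↦ L 1) (mfderiv_comp t hd hγ)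
    rw [← fderiv_apply_one_eq_deriv, ← mfderiv_eq_fderiv] at h1
    exact h2 ▸ h1
  have hsum : HasDerivAt (fun s ↦ ∑ i, ∑ j, f i s * f j s *
      assocForm S (γ s) (Y i (γ s)) (Y j (γ s))) _ t :=
    HasDerivAt.fun_sum fun i _ ↦ HasDerivAt.fun_sum fun j _ ↦ ((hf i).mul (hf j)).mul (hΦ i j)
  have hVt := hV.self_of_nhds
  have hsum_inner (x : M) (a b : ι → TangentSpace 𝓘(ℝ, E) x) :
      (inner ℝ (∑ i, a i) (∑ j, b j) : ℝ) = ∑ i, ∑ j, inner ℝ (a i) (b j) := by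
    simp only [sum_inner, inner_sum]
    exact Finset.sum_comm
  have heq : (fun s ↦ assocForm S (γ s) (V s) (V s)) =ᶠ[𝓝 t] fun s ↦ ∑ i, ∑ j, f i s * f j s *
      assocForm S (γ s) (Y i (γ s)) (Y j (γ s)) := by
    filter_upwards [hV] with s hs
    simp only [hs, assocForm, map_sum, map_smul, hsum_inner, real_inner_smul_left,
      real_inner_smul_right]
    exact Finset.sum_congr rfl fun i _ ↦ Finset.sum_congr rfl fun j _ ↦ by ring
  refine (hsum.congr_of_eventuallyEq heq).congr_deriv ?_
  rw [covDerivAlong_congr hV, covDerivAlong_sum_smul hγ hf hY, hVt, covDerivEnd_sum_smul hS]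
  simp only [assocForm, map_sum, hsum_inner, ← Finset.sum_add_distrib]
  -- Both sides are now double sums over pairs of ambient fields and agree term by term, by the
  -- product rule for Φ(Y i, Y j).
  refine Finset.sum_congr rfl fun i _ ↦ Finset.sum_congr rfl fun j _ ↦ ?_
  have h := mvfderiv_assocForm hS (hY i) (hY j) (velocity γ t)
  simp only [assocForm] at h
  rw [h]
  simp only [map_add, map_smul, inner_add_left, inner_add_right, real_inner_smul_left,
    real_inner_smul_right, Pi.mul_apply]
  ring

/-- Along a geodesic, `d/dt Φ(γ', γ') = g(∇S(γ', γ'), γ')`. -/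
theorem IsGeodesicOn.hasDerivAt_assocForm_velocity (hS : IsSmoothEndomorphism S)
    {γ : ℝ → M} {J : Set ℝ} (hγ : IsGeodesicOn E γ J) {t : ℝ} (ht : t ∈ J) :
    HasDerivAt (fun s ↦ assocForm S (γ s) (velocity γ s) (velocity γ s))
      (inner ℝ (covDerivEnd S (γ t) (velocity γ t) (velocity γ t)) (velocity γ t)) t := by
  have hJ : J ∈ 𝓝 t := hγ.isOpen.mem_nhds ht
  have hd {s : ℝ} (hs : s ∈ J) : MDifferentiableAt 𝓘(ℝ, ℝ) 𝓘(ℝ, E) γ s :=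
    (hγ.contMDiffOn.contMDiffAt (hγ.isOpen.mem_nhds hs)).mdifferentiableAt (by simp)
  have hsrc : ∀ᶠ s in 𝓝 t, γ s ∈ (chartAt E (γ t)).source :=
    (hd ht).continuousAt.eventually (chart_source_mem_nhds E (γ t))
  set c : ℝ → E := extChartAt 𝓘(ℝ, E) (γ t) ∘ γ with hc
  have hc2 : ContDiffAt ℝ 2 c t := by
    have h := (contMDiffAt_extChartAt (I := 𝓘(ℝ, E)) (n := ∞) (x := γ t)).of_le (m := 2) ENat.LEInfty.out
    exact (h.comp t (hγ.contMDiffOn.contMDiffAt hJ)).contDiffAt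
  -- The C² hypothesis on geodesics enters here: the components of γ' in a chart must be
  -- differentiable.
  have hc' : HasDerivAt (deriv c) (deriv (deriv c) t) t := by
    have h : ContDiffAt ℝ 1 (deriv c) t := hc2.derivWithin (by norm_num)
    exact (h.differentiableAt (by simp)).hasDerivAt
  set b := Module.finBasis ℝ E
  have hf (i) : HasDerivAt (fun s ↦ b.repr (deriv c s) i) (b.repr (deriv (deriv c) t) i) t :=
    (LinearMap.toContinuousLinearMap (b.coord i)).hasFDerivAt.comp_hasDerivAt t hc'
  have hV : ∀ᶠ s in 𝓝 t, velocity γ s =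
      ∑ i, b.repr (deriv c s) i • coordFrame (γ t) (b i) (γ s) := by
    filter_upwards [hsrc, hJ] with s hs hsJ
    rw [← coordFrame_trivializationAt hs (velocity γ s), trivializationAt_velocity (hd hsJ) hs,
      ← hc]
    conv_lhs => rw [← b.sum_repr (deriv c s)]
    simp only [coordFrame, map_sum, map_smul]
  have h := hasDerivAt_assocForm_sum_smul hS (hd ht) hf
    (fun i ↦ mdifferentiableAt_coordFrame (mem_chart_source E (γ t)) (b i)) hV
  -- The geodesic equation removes the two terms containing Dγ'/dt.
  simpa [hγ.covDerivAlong_velocity t ht, assocForm] using h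

/-- For a Killing tensor, `Φ(γ', γ')` is constant along geodesics. -/
theorem IsKillingTensor.assocForm_velocity_eq (hS : IsKillingTensor S)
    {γ : ℝ → M} {J : Set ℝ} (hγ : IsGeodesicOn E γ J) {s t : ℝ} (hs : s ∈ J) (ht : t ∈ J) :
    assocForm S (γ s) (velocity γ s) (velocity γ s) =
      assocForm S (γ t) (velocity γ t) (velocity γ t) := by
  have h {r : ℝ} (hr : r ∈ J) := hγ.hasDerivAt_assocForm_velocity hS.smooth hr
  exact hγ.isOpen.is_const_of_deriv_eq_zero hγ.isPreconnected
    (fun r hr ↦ (h hr).differentiableAt.differentiableWithinAt)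
    (fun r hr ↦ by rw [(h hr).deriv, hS.killing]; rfl) hs ht

end AlongCurves

/-! ### Coordinate fields read in a fixed chart. -/

section GeodesicExistence

variable {E : Type*} [NormedAddCommGroup E] [NormedSpace ℝ E]
  {M : Type*} [TopologicalSpace M] [ChartedSpace E M] [IsManifold 𝓘(ℝ, E) ∞ M]

lemma trivializationAt_coordFrame {x y : M} (hy : y ∈ (chartAt E x).source) (a : E) :
    (trivializationAt E (TangentSpace 𝓘(ℝ, E) : M → Type _) x ⟨y, coordFrame x a y⟩).2 = a := by
  have hy' : y ∈ (trivializationAt E (TangentSpace 𝓘(ℝ, E) : M → Type _) x).baseSet := by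
    simpa using hy
  rw [coordFrame, Trivialization.symmL_apply _ hy', Trivialization.apply_mk_symm _ hy']

lemma coordFrame_add (x : M) (a a' : E) (y : M) :
    coordFrame x (a + a') y = coordFrame x a y + coordFrame x a' y := map_add _ _ _

lemma coordFrame_smul (x : M) (c : ℝ) (a : E) (y : M) :
    coordFrame x (c • a) y = c • coordFrame x a y := map_smul _ _ _

lemma coordFrame_sum {ι : Type*} [Fintype ι] (x : M) (a : ι → E) (y : M) :
    coordFrame x (∑ i, a i) y = ∑ i, coordFrame x (a i) y := map_sum _ _ _

lemma coordFrame_neg (x : M) (a : E) (y : M) :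
    coordFrame x (-a) y = -coordFrame x a y := map_neg _ _

lemma extChartAt_symm_mem_chart_source {x : M} {z : E} (hz : z ∈ (extChartAt 𝓘(ℝ, E) x).target) :
    (extChartAt 𝓘(ℝ, E) x).symm z ∈ (chartAt E x).source := by
  simpa using (extChartAt 𝓘(ℝ, E) x).map_target hz

lemma contMDiffAt_extChartAt_symm {x : M} {z : E} (hz : z ∈ (extChartAt 𝓘(ℝ, E) x).target) :
    ContMDiffAt 𝓘(ℝ, E) 𝓘(ℝ, E) ∞ (extChartAt 𝓘(ℝ, E) x).symm z :=
  (contMDiffOn_extChartAt_symm x).contMDiffAt ((isOpen_extChartAt_target x).mem_nhds hz)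

lemma mdifferentiableAt_extChartAt_symm {x : M} {z : E}
    (hz : z ∈ (extChartAt 𝓘(ℝ, E) x).target) :
    MDifferentiableAt 𝓘(ℝ, E) 𝓘(ℝ, E) (extChartAt 𝓘(ℝ, E) x).symm z :=
  (contMDiffAt_extChartAt_symm hz).mdifferentiableAt (by simp)

/-- Coordinate fields are pushforwards of constant fields under the inverse chart; hence
differentiating along them is taking partial derivatives. -/
lemma coordFrame_extChartAt_symm {x : M} {z : E} (hz : z ∈ (extChartAt 𝓘(ℝ, E) x).target) (a : E) :
    coordFrame x a ((extChartAt 𝓘(ℝ, E) x).symm z) =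
      mfderiv 𝓘(ℝ, E) 𝓘(ℝ, E) (extChartAt 𝓘(ℝ, E) x).symm z a := by
  have h := TangentBundle.symmL_trivializationAt (I := 𝓘(ℝ, E))
    (extChartAt_symm_mem_chart_source hz)
  rw [(extChartAt 𝓘(ℝ, E) x).right_inv hz, ModelWithCorners.range_eq_univ, mfderivWithin_univ] at h
  exact congrArg (fun L : E →L[ℝ] E ↦ L a) h

lemma contDiffAt_comp_extChartAt_symm {n : ℕ∞} {F : Type*} [NormedAddCommGroup F]
    [NormedSpace ℝ F] {x : M} {z : E} (hz : z ∈ (extChartAt 𝓘(ℝ, E) x).target) {f : M → F}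
    (hf : ContMDiffAt 𝓘(ℝ, E) 𝓘(ℝ, F) n f ((extChartAt 𝓘(ℝ, E) x).symm z)) :
    ContDiffAt ℝ n (fun z ↦ f ((extChartAt 𝓘(ℝ, E) x).symm z)) z :=
  (hf.comp z ((contMDiffAt_extChartAt_symm hz).of_le (mod_cast le_top))).contDiffAt

lemma mvfderiv_coordFrame {x : M} {z : E} (hz : z ∈ (extChartAt 𝓘(ℝ, E) x).target) {f : M → ℝ}
    (hf : MDiffAt f ((extChartAt 𝓘(ℝ, E) x).symm z)) (a : E) :
    mvfderiv 𝓘(ℝ, E) f ((extChartAt 𝓘(ℝ, E) x).symm z)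
        (coordFrame x a ((extChartAt 𝓘(ℝ, E) x).symm z)) =
      fderiv ℝ (fun z ↦ f ((extChartAt 𝓘(ℝ, E) x).symm z)) z a := by
  have h := congrArg (fun L : E →L[ℝ] ℝ ↦ L a)
    (mfderiv_comp z hf (mdifferentiableAt_extChartAt_symm hz))
  rw [coordFrame_extChartAt_symm hz, ← mfderiv_eq_fderiv]
  exact h.symm

/-! ### Koszul formula and regularity of the Christoffel symbols. -/

variable [FiniteDimensional ℝ E]
  [RiemannianBundle (TangentSpace 𝓘(ℝ, E) : M → Type _)]
  [IsContMDiffRiemannianBundle 𝓘(ℝ, E) ∞ E (TangentSpace 𝓘(ℝ, E) : M → Type _)]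

lemma contMDiffAt_inner {n : ℕ∞} {x : M} {Y Z : Π y : M, TangentSpace 𝓘(ℝ, E) y}
    (hY : ContMDiffAt 𝓘(ℝ, E) 𝓘(ℝ, E).tangent n (T% Y) x)
    (hZ : ContMDiffAt 𝓘(ℝ, E) 𝓘(ℝ, E).tangent n (T% Z) x) :
    ContMDiffAt 𝓘(ℝ, E) 𝓘(ℝ, ℝ) n (fun y ↦ (inner ℝ (Y y) (Z y) : ℝ)) x :=
  haveI : IsContMDiffRiemannianBundle 𝓘(ℝ, E) n E (TangentSpace 𝓘(ℝ, E) : M → Type _) :=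
    .of_le (n := ∞) (mod_cast le_top)
  ContMDiffAt.inner_bundle (F := E) (IB := 𝓘(ℝ, E))
    (E := (TangentSpace 𝓘(ℝ, E) : M → Type _)) (b := fun y ↦ y) hY hZ

/-- The Koszul formula. -/
lemma koszul {x : M} {X Y Z : Π y : M, TangentSpace 𝓘(ℝ, E) y}
    (hX : MDiffAt (T% X) x) (hY : MDiffAt (T% Y) x) (hZ : MDiffAt (T% Z) x) :
    2 * inner ℝ (leviCivita E M Y x (X x)) (Z x) =
      mvfderiv 𝓘(ℝ, E) (fun y ↦ inner ℝ (Y y) (Z y)) x (X x)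
        + mvfderiv 𝓘(ℝ, E) (fun y ↦ inner ℝ (X y) (Z y)) x (Y x)
        - mvfderiv 𝓘(ℝ, E) (fun y ↦ inner ℝ (X y) (Y y)) x (Z x)
        + inner ℝ (VectorField.mlieBracket 𝓘(ℝ, E) X Y x) (Z x)
        - inner ℝ (VectorField.mlieBracket 𝓘(ℝ, E) X Z x) (Y x)
        - inner ℝ (VectorField.mlieBracket 𝓘(ℝ, E) Y Z x) (X x) := by
  have : CompleteSpace E := FiniteDimensional.complete ℝ E
  have ht {X Y : Π y : M, TangentSpace 𝓘(ℝ, E) y} (hX : MDiffAt (T% X) x)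
      (hY : MDiffAt (T% Y) x) : leviCivita E M Y x (X x) - leviCivita E M X x (Y x) =
        VectorField.mlieBracket 𝓘(ℝ, E) X Y x :=
    (leviCivita E M).torsion_eq_zero_iff.1 leviCivita_torsion hX hY
  rw [← ht hX hY, ← ht hX hZ, ← ht hY hZ, mvfderiv_inner_leviCivita hY hZ,
    mvfderiv_inner_leviCivita hX hZ, mvfderiv_inner_leviCivita hX hY]
  simp only [inner_sub_left]
  rw [real_inner_comm (Y x) (leviCivita E M Z x (X x)),
    real_inner_comm (X x) (leviCivita E M Z x (Y x)),
    real_inner_comm (X x) (leviCivita E M Y x (Z x))]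
  ring

lemma contDiffAt_inner_coordFrame {x : M} {z : E} (hz : z ∈ (extChartAt 𝓘(ℝ, E) x).target)
    (a b : E) : ContDiffAt ℝ ∞ (fun z ↦ (inner ℝ
      (coordFrame x a ((extChartAt 𝓘(ℝ, E) x).symm z))
      (coordFrame x b ((extChartAt 𝓘(ℝ, E) x).symm z)) : ℝ)) z :=
  contDiffAt_comp_extChartAt_symm (n := ⊤) hz
    (contMDiffAt_inner (contMDiffAt_coordFrame (extChartAt_symm_mem_chart_source hz) a)
      (contMDiffAt_coordFrame (extChartAt_symm_mem_chart_source hz) b))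

/-- The components `g(∇_a ∂_b, ∂_c)` of the connection in a chart are `C¹`. -/
lemma contDiffAt_inner_leviCivita_coordFrame {x : M} {z : E}
    (hz : z ∈ (extChartAt 𝓘(ℝ, E) x).target) (a b c : E) :
    ContDiffAt ℝ 1 (fun z ↦ (inner ℝ
      (leviCivita E M (coordFrame x b) ((extChartAt 𝓘(ℝ, E) x).symm z)
        (coordFrame x a ((extChartAt 𝓘(ℝ, E) x).symm z)))
      (coordFrame x c ((extChartAt 𝓘(ℝ, E) x).symm z)) : ℝ)) z := by
  have : CompleteSpace E := FiniteDimensional.complete ℝ E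
  have hfd (a b c : E) : ContDiffAt ℝ 1 (fun z ↦ fderiv ℝ (fun z ↦ (inner ℝ
      (coordFrame x a ((extChartAt 𝓘(ℝ, E) x).symm z))
      (coordFrame x b ((extChartAt 𝓘(ℝ, E) x).symm z)) : ℝ)) z c) z :=
    ((contDiffAt_inner_coordFrame hz a b).fderiv_right (m := 1) (n := ∞)
      (by rw [one_add_one_eq_two]; exact ENat.LEInfty.out)).clm_apply
      contDiffAt_const
  -- The bracket terms are not shown to be zero; it suffices that the bracket of C² fields is C¹.
  have hlb (a b c : E) : ContDiffAt ℝ 1 (fun z ↦ (inner ℝ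
      (VectorField.mlieBracket 𝓘(ℝ, E) (coordFrame x a) (coordFrame x b)
        ((extChartAt 𝓘(ℝ, E) x).symm z))
      (coordFrame x c ((extChartAt 𝓘(ℝ, E) x).symm z)) : ℝ)) z := by
    have hy := extChartAt_symm_mem_chart_source hz
    have : IsManifold 𝓘(ℝ, E) (((2 : ℕ∞) : WithTop ℕ∞) + 1) M :=
      .of_le (n := ∞) (mod_cast le_top)
    have : IsManifold 𝓘(ℝ, E) (minSmoothness ℝ 2) M :=
      .of_le (n := ∞) (by
        rw [minSmoothness_of_isRCLikeNormedField]; exact ENat.LEInfty.out)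
    have h := ContMDiffAt.mlieBracket_vectorField (m := 1) (n := 2)
      ((contMDiffAt_coordFrame hy a).of_le (mod_cast le_top))
      ((contMDiffAt_coordFrame hy b).of_le (mod_cast le_top)) (by
        simp only [minSmoothness_of_isRCLikeNormedField]; norm_num)
    exact contDiffAt_comp_extChartAt_symm (n := 1) hz
      (contMDiffAt_inner h ((contMDiffAt_coordFrame hy c).of_le (mod_cast le_top)))
  have h := (((((hfd b c a).add (hfd a c b)).sub (hfd a b c)).add (hlb a b c)).sub
    (hlb a c b)).sub (hlb b c a)
  refine ((contDiffAt_const (c := (2 : ℝ)⁻¹)).mul h).congr_of_eventuallyEq ?_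
  filter_upwards [(isOpen_extChartAt_target x).mem_nhds hz] with w hw
  have hd (a : E) := mdifferentiableAt_coordFrame (extChartAt_symm_mem_chart_source hw) a
  have hk := koszul (hd a) (hd b) (hd c)
  rw [mvfderiv_coordFrame hw (mdifferentiableAt_inner (hd b) (hd c)),
    mvfderiv_coordFrame hw (mdifferentiableAt_inner (hd a) (hd c)),
    mvfderiv_coordFrame hw (mdifferentiableAt_inner (hd a) (hd b))] at hk
  rw [eq_inv_mul_iff_mul_eq₀ two_ne_zero]
  exact hk

/-- The matrix of the metric in the preferred chart at `x`. -/
def gramOperator (x : M) (z : E) : E →L[ℝ] E →L[ℝ] ℝ :=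
  (LinearMap.mk₂ ℝ (fun a b ↦ (inner ℝ (coordFrame x a ((extChartAt 𝓘(ℝ, E) x).symm z))
      (coordFrame x b ((extChartAt 𝓘(ℝ, E) x).symm z)) : ℝ))
    (fun a a' b ↦ by rw [coordFrame_add, inner_add_left])
    (fun c a b ↦ by rw [coordFrame_smul, real_inner_smul_left, smul_eq_mul])
    (fun a b b' ↦ by rw [coordFrame_add, inner_add_right])
    (fun c a b ↦ by rw [coordFrame_smul, real_inner_smul_right, smul_eq_mul])
    ).toContinuousBilinearMap

lemma gramOperator_apply (x : M) (z a b : E) :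
    gramOperator x z a b = inner ℝ (coordFrame x a ((extChartAt 𝓘(ℝ, E) x).symm z))
      (coordFrame x b ((extChartAt 𝓘(ℝ, E) x).symm z)) := by
  simp [gramOperator]

/-- Positive definiteness makes the Gram operator injective, and E and its dual have equal
dimension. -/
lemma exists_gramOperator_eq_equiv {x : M} {z : E} (hz : z ∈ (extChartAt 𝓘(ℝ, E) x).target) :
    ∃ e : E ≃L[ℝ] (E →L[ℝ] ℝ), (e : E →L[ℝ] E →L[ℝ] ℝ) = gramOperator x z := by
  have hinj : Function.Injective (gramOperator x z : E →ₗ[ℝ] E →L[ℝ] ℝ) := by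
    rw [← LinearMap.ker_eq_bot, LinearMap.ker_eq_bot']
    intro a ha
    have h : gramOperator x z a a = 0 := congrArg (fun L : E →L[ℝ] ℝ ↦ L a) ha
    rw [gramOperator_apply, inner_self_eq_zero] at h
    have h0 : coordFrame x (0 : E) ((extChartAt 𝓘(ℝ, E) x).symm z) = 0 := map_zero _
    rw [← trivializationAt_coordFrame (extChartAt_symm_mem_chart_source hz) a, h, ← h0,
      trivializationAt_coordFrame (extChartAt_symm_mem_chart_source hz)]
  have hdim : Module.finrank ℝ E = Module.finrank ℝ (E →L[ℝ] ℝ) := by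
    rw [← (LinearMap.toContinuousLinearMap (𝕜 := ℝ) (E := E) (F' := ℝ)).finrank_eq]
    exact (Subspace.dual_finrank_eq (K := ℝ) (V := E)).symm
  refine ⟨(LinearMap.linearEquivOfInjective _ hinj hdim).toContinuousLinearEquiv, ?_⟩
  ext a b
  rfl

lemma contDiffOn_gramOperator (x : M) :
    ContDiffOn ℝ 1 (gramOperator (E := E) x) (extChartAt 𝓘(ℝ, E) x).target := by
  refine contDiffOn_clm_apply.2 fun a ↦ contDiffOn_clm_apply.2 fun b z hz ↦ ?_
  simp only [gramOperator_apply]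
  exact ((contDiffAt_inner_coordFrame hz a b).of_le (mod_cast le_top)).contDiffWithinAt

/-- Christoffel symbols of the second kind in the preferred chart at `x`. -/
def chartChristoffel (x : M) (a b z : E) : E :=
  (trivializationAt E (TangentSpace 𝓘(ℝ, E) : M → Type _) x
    ⟨(extChartAt 𝓘(ℝ, E) x).symm z, leviCivita E M (coordFrame x b)
      ((extChartAt 𝓘(ℝ, E) x).symm z) (coordFrame x a ((extChartAt 𝓘(ℝ, E) x).symm z))⟩).2

lemma coordFrame_chartChristoffel {x : M} {z : E} (hz : z ∈ (extChartAt 𝓘(ℝ, E) x).target)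
    (a b : E) :
    coordFrame x (chartChristoffel (M := M) x a b z) ((extChartAt 𝓘(ℝ, E) x).symm z) =
      leviCivita E M (coordFrame x b) ((extChartAt 𝓘(ℝ, E) x).symm z)
        (coordFrame x a ((extChartAt 𝓘(ℝ, E) x).symm z)) :=
  coordFrame_trivializationAt (extChartAt_symm_mem_chart_source hz) _

-- Raising an index: the Gram operator applied to the symbols has C¹ components g(∇_a ∂_b, ∂_c), and
-- operator inversion is smooth at invertible operators.
set_option synthInstance.maxHeartbeats 200000 in
lemma contDiffAt_chartChristoffel {x : M} {z : E} (hz : z ∈ (extChartAt 𝓘(ℝ, E) x).target)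
    (a b : E) : ContDiffAt ℝ 1 (chartChristoffel (M := M) x a b) z := by
  have : CompleteSpace E := FiniteDimensional.complete ℝ E
  have hT := (isOpen_extChartAt_target (I := 𝓘(ℝ, E)) x).mem_nhds hz
  have h1 : ContDiffOn ℝ 1 (fun z ↦ gramOperator x z (chartChristoffel (M := M) x a b z))
      (extChartAt 𝓘(ℝ, E) x).target := by
    refine contDiffOn_clm_apply.2 fun c w hw ↦ ?_
    refine ((contDiffAt_inner_leviCivita_coordFrame hw a b c).congr_of_eventuallyEq
      ?_).contDiffWithinAt
    filter_upwards [(isOpen_extChartAt_target x).mem_nhds hw] with u hu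
    rw [gramOperator_apply, coordFrame_chartChristoffel hu]
  obtain ⟨e, he⟩ := exists_gramOperator_eq_equiv hz
  have h2 : ContDiffAt ℝ 1 (fun z ↦ (gramOperator x z).inverse) z := by
    have hinv : ContDiffAt ℝ 1 (ContinuousLinearMap.inverse (R := ℝ) (M := E) (M₂ := E →L[ℝ] ℝ))
        (gramOperator x z) := by
      rw [← he]
      exact contDiffAt_map_inverse e
    exact hinv.comp z ((contDiffOn_gramOperator x).contDiffAt hT)
  refine (h2.clm_apply (h1.contDiffAt hT)).congr_of_eventuallyEq ?_
  -- `ContinuousLinearMap.inverse` is a genuine inverse only at invertible operators, so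
  -- invertibility is needed on a whole neighbourhood.
  filter_upwards [hT] with w hw
  obtain ⟨e', he'⟩ := exists_gramOperator_eq_equiv hw
  rw [← he', ContinuousLinearMap.inverse_equiv]
  simp

/-! ### The geodesic equation in a chart and its local solutions. -/

/-- The quadratic term of the geodesic equation in the preferred chart at `x`. -/
def geodesicForce (x : M) (p : E × E) : E :=
  ∑ i, ∑ j, ((Module.finBasis ℝ E).repr p.2 i * (Module.finBasis ℝ E).repr p.2 j) •
    chartChristoffel (M := M) x (Module.finBasis ℝ E i) (Module.finBasis ℝ E j) p.1

lemma contDiffAt_geodesicForce {x : M} {p : E × E} (hp : p.1 ∈ (extChartAt 𝓘(ℝ, E) x).target) :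
    ContDiffAt ℝ 1 (geodesicForce (M := M) x) p := by
  have hc (i) : ContDiff ℝ 1 (fun q : E × E ↦ (Module.finBasis ℝ E).repr q.2 i) :=
    (LinearMap.toContinuousLinearMap ((Module.finBasis ℝ E).coord i)).contDiff.comp contDiff_snd
  refine ContDiffAt.sum fun i _ ↦ ContDiffAt.sum fun j _ ↦ ?_
  exact ((hc i).contDiffAt.mul (hc j).contDiffAt).smul
    ((contDiffAt_chartChristoffel hp _ _).comp p contDiffAt_fst)

lemma coordFrame_geodesicForce {x : M} {p : E × E} (hp : p.1 ∈ (extChartAt 𝓘(ℝ, E) x).target) :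
    coordFrame x (geodesicForce (M := M) x p) ((extChartAt 𝓘(ℝ, E) x).symm p.1) =
      ∑ j, (Module.finBasis ℝ E).repr p.2 j • leviCivita E M
        (coordFrame x (Module.finBasis ℝ E j)) ((extChartAt 𝓘(ℝ, E) x).symm p.1)
        (coordFrame x p.2 ((extChartAt 𝓘(ℝ, E) x).symm p.1)) := by
  have h : coordFrame x p.2 ((extChartAt 𝓘(ℝ, E) x).symm p.1) =
      ∑ i, (Module.finBasis ℝ E).repr p.2 i •
        coordFrame x (Module.finBasis ℝ E i) ((extChartAt 𝓘(ℝ, E) x).symm p.1) := by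
    conv_lhs => rw [← (Module.finBasis ℝ E).sum_repr p.2]
    simp only [coordFrame_sum, coordFrame_smul]
  rw [h]
  simp only [geodesicForce, coordFrame_sum, coordFrame_smul, coordFrame_chartChristoffel hp,
    map_sum, map_smul, Finset.smul_sum, smul_smul]
  rw [Finset.sum_comm]
  exact Finset.sum_congr rfl fun i _ ↦ Finset.sum_congr rfl fun j _ ↦ by rw [mul_comm]

/-- A solution of the geodesic equation in a chart is a geodesic. -/
lemma isGeodesicOn_of_hasDerivAt {x : M} {u v : ℝ → E} {J : Set ℝ} (hJ : IsOpen J)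
    (hJc : IsPreconnected J) (hu : ∀ t ∈ J, HasDerivAt u (v t) t)
    (hv : ∀ t ∈ J, HasDerivAt v (-geodesicForce (M := M) x (u t, v t)) t)
    (huT : ∀ t ∈ J, u t ∈ (extChartAt 𝓘(ℝ, E) x).target) :
    (∀ t ∈ J, velocity (E := E) ((extChartAt 𝓘(ℝ, E) x).symm ∘ u) t =
        coordFrame x (v t) ((extChartAt 𝓘(ℝ, E) x).symm (u t))) ∧
      IsGeodesicOn E ((extChartAt 𝓘(ℝ, E) x).symm ∘ u) J := by
  have hmd (t) (ht : t ∈ J) : MDifferentiableAt 𝓘(ℝ, ℝ) 𝓘(ℝ, E)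
      ((extChartAt 𝓘(ℝ, E) x).symm ∘ u) t :=
    (mdifferentiableAt_extChartAt_symm (huT t ht)).comp t
      (hu t ht).differentiableAt.mdifferentiableAt
  have hvel (t) (ht : t ∈ J) : velocity (E := E) ((extChartAt 𝓘(ℝ, E) x).symm ∘ u) t =
      coordFrame x (v t) ((extChartAt 𝓘(ℝ, E) x).symm (u t)) := by
    have h := congrArg (fun L : ℝ →L[ℝ] E ↦ L 1) (mfderiv_comp t
      (mdifferentiableAt_extChartAt_symm (huT t ht)) (hu t ht).differentiableAt.mdifferentiableAt)
    rw [coordFrame_extChartAt_symm (huT t ht), ← (hu t ht).deriv, ← fderiv_apply_one_eq_deriv,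
      ← mfderiv_eq_fderiv]
    exact h
  -- Bootstrapping: v' = -force(u, v) is continuous, so v is C¹; then u' = v makes u of class C².
  have hv1 : ContDiffOn ℝ 1 v J := by
    rw [← zero_add 1, contDiffOn_succ_iff_deriv_of_isOpen hJ, contDiffOn_zero]
    refine ⟨fun t ht ↦ (hv t ht).differentiableAt.differentiableWithinAt, by simp,
      ContinuousOn.congr (fun t ht ↦ ?_) fun t ht ↦ (hv t ht).deriv⟩
    exact (ContinuousAt.comp (g := geodesicForce (M := M) x) (f := fun t ↦ (u t, v t))
      (contDiffAt_geodesicForce (huT t ht)).continuousAt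
      ((hu t ht).continuousAt.prodMk (hv t ht).continuousAt)).neg.continuousWithinAt
  have hu2 : ContDiffOn ℝ 2 u J := by
    rw [show (2 : WithTop ℕ∞) = 1 + 1 by norm_num, contDiffOn_succ_iff_deriv_of_isOpen hJ]
    exact ⟨fun t ht ↦ (hu t ht).differentiableAt.differentiableWithinAt, by simp,
      hv1.congr fun t ht ↦ (hu t ht).deriv⟩
  refine ⟨hvel, hJ, hJc, fun t ht ↦ ?_, fun t ht ↦ ?_⟩
  · exact (((contMDiffAt_extChartAt_symm (huT t ht)).of_le ENat.LEInfty.out).comp t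
      (hu2.contDiffAt (hJ.mem_nhds ht)).contMDiffAt).contMDiffWithinAt
  · have hV : ∀ᶠ s in 𝓝 t, velocity (E := E) ((extChartAt 𝓘(ℝ, E) x).symm ∘ u) s =
        ∑ i, (Module.finBasis ℝ E).repr (v s) i • coordFrame x (Module.finBasis ℝ E i)
          (((extChartAt 𝓘(ℝ, E) x).symm ∘ u) s) := by
      filter_upwards [hJ.mem_nhds ht] with s hs
      rw [hvel s hs]
      conv_lhs => rw [← (Module.finBasis ℝ E).sum_repr (v s)]
      simp only [coordFrame_sum, coordFrame_smul, Function.comp_apply]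
    have hf (i) : HasDerivAt (fun s ↦ (Module.finBasis ℝ E).repr (v s) i)
        ((Module.finBasis ℝ E).repr (-geodesicForce (M := M) x (u t, v t)) i) t :=
      (LinearMap.toContinuousLinearMap
        ((Module.finBasis ℝ E).coord i)).hasFDerivAt.comp_hasDerivAt t (hv t ht)
    rw [covDerivAlong_congr hV, covDerivAlong_sum_smul (hmd t ht) hf fun i ↦
      mdifferentiableAt_coordFrame (extChartAt_symm_mem_chart_source (huT t ht)) _,
      Finset.sum_add_distrib, hvel t ht]
    -- The derivatives of the coefficients assemble to minus the force, and the connection terms to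
    -- plus the force.
    simp only [← coordFrame_smul, ← coordFrame_sum, Module.Basis.sum_repr, coordFrame_neg]
    rw [Function.comp_apply, coordFrame_geodesicForce (p := (u t, v t)) (huT t ht)]
    exact neg_add_cancel _

/-- Local existence of geodesics with prescribed initial velocity. -/
theorem exists_isGeodesicOn (x : M) (w : TangentSpace 𝓘(ℝ, E) x) :
    ∃ (γ : ℝ → M) (J : Set ℝ), IsGeodesicOn E γ J ∧ (0 : ℝ) ∈ J ∧
      (⟨γ 0, velocity γ 0⟩ : TangentBundle 𝓘(ℝ, E) M) = ⟨x, w⟩ := by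
  have : CompleteSpace E := FiniteDimensional.complete ℝ E
  set a := (trivializationAt E (TangentSpace 𝓘(ℝ, E) : M → Type _) x ⟨x, w⟩).2
  have hx := mem_extChartAt_target (I := 𝓘(ℝ, E)) x
  -- The second-order equation becomes the autonomous system u' = v, v' = -force(u, v) on E × E, to
  -- which Picard–Lindelöf applies.
  have hX : ContDiffAt ℝ 1 (fun p : E × E ↦ (p.2, -geodesicForce (M := M) x p))
      (extChartAt 𝓘(ℝ, E) x x, a) :=
    contDiffAt_snd.prodMk (contDiffAt_geodesicForce hx).neg
  obtain ⟨α, hα0, ε, hε, hα⟩ :=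
    hX.exists_forall_mem_closedBall_exists_eq_forall_mem_Ioo_hasDerivAt₀ 0
  have h0 : (0 : ℝ) ∈ Set.Ioo (0 - ε) (0 + ε) := by constructor <;> linarith
  have hcont : ContinuousAt (fun t ↦ (α t).1) 0 := (hα 0 h0).continuousAt.fst
  have hnhds : ∀ᶠ t in 𝓝 (0 : ℝ), t ∈ Set.Ioo (0 - ε) (0 + ε) ∧
      (α t).1 ∈ (extChartAt 𝓘(ℝ, E) x).target := by
    refine (isOpen_Ioo.eventually_mem h0).and (hcont.eventually ?_)
    simp only [hα0]
    exact (isOpen_extChartAt_target x).mem_nhds hx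
  obtain ⟨δ, hδ, hball⟩ := Metric.eventually_nhds_iff_ball.1 hnhds
  obtain ⟨hvel, hgeo⟩ := isGeodesicOn_of_hasDerivAt (M := M) (x := x) (u := fun t ↦ (α t).1)
    (v := fun t ↦ (α t).2) (J := Metric.ball 0 δ) Metric.isOpen_ball
    (convex_ball _ _).isPreconnected (fun t ht ↦ (hα t (hball t ht).1).fst)
    (fun t ht ↦ (hα t (hball t ht).1).snd) (fun t ht ↦ (hball t ht).2)
  refine ⟨_, _, hgeo, Metric.mem_ball_self hδ, ?_⟩
  rw [hvel 0 (Metric.mem_ball_self hδ)]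
  simp only [Function.comp_apply, hα0]
  -- The starting point of γ equals x only propositionally, so the vectors are compared in the total
  -- space, with a variable base point.
  have h (y : M) (hy : y = x) :
      (⟨y, coordFrame x a y⟩ : TangentBundle 𝓘(ℝ, E) M) = ⟨x, w⟩ := by
    subst hy
    rw [coordFrame_trivializationAt (mem_chart_source E y) w]
  exact h _ (by rw [hα0]; exact extChartAt_to_inv x)

end GeodesicExistence

end RiemannianGeometry

end


theorem proposition1p1
    {E : Type*} [NormedAddCommGroup E] [NormedSpace ℝ E] [FiniteDimensional ℝ E]
    {M : Type*} [TopologicalSpace M] [T2Space M] [ConnectedSpace M]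
    [ChartedSpace E M] [IsManifold 𝓘(ℝ, E) ∞ M]
    [RiemannianBundle (TangentSpace 𝓘(ℝ, E) : M → Type _)]
    [IsContMDiffRiemannianBundle 𝓘(ℝ, E) ∞ E (TangentSpace 𝓘(ℝ, E) : M → Type _)]
    (S : Π x : M, TangentSpace 𝓘(ℝ, E) x →L[ℝ] TangentSpace 𝓘(ℝ, E) x)
    (hS : RiemannianGeometry.IsSmoothEndomorphism S)
    (hsymm : RiemannianGeometry.IsSymmetricEndomorphism S) :
    List.TFAE [
      RiemannianGeometry.IsKillingTensor S,
      ∀ (γ : ℝ → M) (J : Set ℝ), RiemannianGeometry.IsGeodesicOn E γ J →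
        ∀ s ∈ J, ∀ t ∈ J,
          RiemannianGeometry.assocForm S (γ s)
              (RiemannianGeometry.velocity γ s) (RiemannianGeometry.velocity γ s) =
            RiemannianGeometry.assocForm S (γ t)
              (RiemannianGeometry.velocity γ t) (RiemannianGeometry.velocity γ t),
      ∀ X Y Z : Π x : M, TangentSpace 𝓘(ℝ, E) x,
        RiemannianGeometry.IsSmoothVectorField X → RiemannianGeometry.IsSmoothVectorField Y →
        RiemannianGeometry.IsSmoothVectorField Z → ∀ x : M,
          RiemannianGeometry.covDerivForm (RiemannianGeometry.assocForm S) X Y Z x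
            + RiemannianGeometry.covDerivForm (RiemannianGeometry.assocForm S) Z X Y x
            + RiemannianGeometry.covDerivForm (RiemannianGeometry.assocForm S) Y Z X x = 0] := by
  tfae_have 1 ↔ 3 := RiemannianGeometry.isKillingTensor_iff_cyclic hS hsymm
  tfae_have 1 → 2 := fun h γ J hγ s hs t ht ↦ h.assocForm_velocity_eq hγ hs ht
  tfae_have 2 → 1 := by
    refine fun h ↦ ⟨hS, hsymm, fun x v ↦ ?_⟩
    obtain ⟨γ, J, hγ, h0, hp⟩ := RiemannianGeometry.exists_isGeodesicOn x v
    have hd := hγ.hasDerivAt_assocForm_velocity hS h0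
    have hconst : HasDerivAt (fun s ↦ RiemannianGeometry.assocForm S (γ s)
        (RiemannianGeometry.velocity γ s) (RiemannianGeometry.velocity γ s)) 0 0 :=
      (hasDerivAt_const 0 _).congr_of_eventuallyEq
        (Filter.eventually_of_mem (hγ.isOpen.mem_nhds h0) fun s hs ↦ h γ J hγ s hs 0 h0)
    have hz := hd.unique hconst
    -- The cubic form is viewed as a function on the total space of TM, which carries its vanishing
    -- from γ'(0) to v despite the different fibres.
    exact (congrArg (fun p : TangentBundle 𝓘(ℝ, E) M ↦ (inner ℝ
      (RiemannianGeometry.covDerivEnd S p.1 p.2 p.2) p.2 : ℝ)) hp).symm.trans hz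
  tfae_finish
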